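/- For $z\in\mathbb{C}\setminus\mathbb{Z}_{\le 0}$ let $\psi(z)=\Gamma'(z)/\Gamma(z)$ be the digamma function, let $H_m=\sum_{i=1}^m \frac1i$, let $G=\sum_{k\ge 0}\frac{(-1)^k}{(2k+1)^2}$ be Catalan's constant, and let $\mathrm{Li}_3$ be the trilogarithm, i.e. the analytic continuation of $\sum_{k\ge1} z^k/k^3$ to $\mathbb{C}\setminus[1,\infty)$. Let $n\ge 0$ be an integer and put $$C=\frac{\pi^3}{6}+2G\ln 2+\frac{\pi}{4}\ln^2 2-4\,\mathrm{Im}\,\mathrm{Li}_3(1+i).$$ Then the series $$S_n=\sum_{k=1}^\infty\frac{\psi\left(\frac{k+2n+5}{4}\right)-\psi\left(\frac{k+2n+3}{4}\right)}{k^2}$$ converges (absolutely), and its sum is as follows. If $n=0$: $\; S_0=-4+\frac{2\pi^2}{3}-C$. If $n=1$: $\; S_1=\frac{86}{27}-\frac{4\pi^2}{9}+C$. If $n$ is odd and $n\ne 1$: $$S_n=\frac{86}{27}-2\sum_{j=1}^{\frac{n-1}{2}}\frac{8j+5}{(2j+1)(4j+3)^3}+32\sum_{j=1}^{\frac{n-1}{2}}\frac{(2j+1)H_{4j+1}}{(4j+3)^2(4j+1)^2}-\left(\frac49+\frac43\sum_{j=1}^{\frac{n-1}{2}}\frac{1}{(4j+3)(4j+1)}\right)\pi^2+C.$$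 If $n$ is even (empty sums being $0$): $$S_n=-4-\sum_{j=0}^{\frac{n-2}{2}}\frac{8j+9}{(j+1)(4j+5)^3}+64\sum_{j=0}^{\frac{n-2}{2}}\frac{(j+1)H_{4j+3}}{(4j+5)^2(4j+3)^2}+\left(\frac23-\frac43\sum_{j=0}^{\frac{n-2}{2}}\frac{1}{(4j+5)(4j+3)}\right)\pi^2-C.$$ -/

import Mathlib

open Complex Set MeasureTheory

/-- Catalan's constant `G = ∑_{k ≥ 0} (-1)^k / (2k+1)^2`. -/
noncomputable def catalanConst : ℝ :=
  ∑' k : ℕ, (-1 : ℝ) ^ k / (2 * (k : ℝ) + 1) ^ 2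

/-- The (principal branch of the) polylogarithm `Li_s(z)` for `Re s > 0` and
`z ∈ ℂ \ [1, ∞)`, by its Bose-Einstein integral. It agrees with `∑_{k ≥ 1} z^k / k^s` for
`|z| ≤ 1`, `Re s > 1` (see `hasSum_polylog`), and it is holomorphic in `z` off the cut
`[1, ∞)` (see `differentiableOn_polylog`), so it is the analytic continuation of that series. -/
noncomputable def polylog (s z : ℂ) : ℂ :=
  z / Complex.Gamma s *
    ∫ t in Ioi (0 : ℝ), (t : ℂ) ^ (s - 1) / (Complex.exp t - z)

theorem hasSum_polylog {s z : ℂ} (hs : 1 < s.re) (hz : ‖z‖ ≤ 1) :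
    HasSum (fun k : ℕ => z ^ (k + 1) / ((k : ℂ) + 1) ^ s) (polylog s z) := by
  have hs0 : 0 < s.re := by linarith
  have hG : Complex.Gamma s ≠ 0 := Complex.Gamma_ne_zero_of_re_pos hs0
  have key := hasSum_mellin (a := fun k : ℕ => z ^ (k + 1)) (p := fun k : ℕ => (k : ℝ) + 1)
    (F := fun t : ℝ => z / (Complex.exp t - z)) (s := s) (fun i => Or.inr (by positivity)) hs0
    (by
      intro t ht
      have ht' : (0 : ℝ) < t := ht
      have hlt : ‖z * Complex.exp (-(t : ℂ))‖ < 1 := by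
        rw [norm_mul, Complex.norm_exp]
        have h1 : Real.exp (-(t : ℂ)).re < 1 := by simpa using ht'
        have h2 := Real.exp_pos (-(t : ℂ)).re
        nlinarith [norm_nonneg z]
      have hg := (hasSum_geometric_of_norm_lt_one hlt).mul_left (z * Complex.exp (-(t : ℂ)))
      have hne : 1 - z * Complex.exp (-(t : ℂ)) ≠ 0 := by
        intro h
        rw [← sub_eq_zero.mp h] at hlt
        simp at hlt
      convert! hg using 1
      · funext k
        rw [← pow_succ', mul_pow, ← Complex.exp_nat_mul]
        push_cast
        congr 2
        ring
      · have he : Complex.exp (t : ℂ) - z = Complex.exp t * (1 - z * Complex.exp (-(t : ℂ))) := by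
          rw [mul_sub, mul_left_comm, ← Complex.exp_add]
          simp
        rw [he, Complex.exp_neg]
        have := Complex.exp_ne_zero (t : ℂ)
        rw [Complex.exp_neg] at hne
        field_simp)
    (by
      have h0 : Summable fun i : ℕ => 1 / ((i : ℝ) + 1) ^ s.re := by
        have := (summable_nat_add_iff 1).mpr (Real.summable_one_div_nat_rpow.mpr hs)
        simpa using this
      refine Summable.of_nonneg_of_le (fun i => by positivity) (fun i => ?_) h0
      rw [norm_pow]
      gcongr
      exact pow_le_one₀ (norm_nonneg _) hz)
  have h2 := key.mul_left (Complex.Gamma s)⁻¹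
  convert! h2 using 1
  · funext k
    push_cast
    field_simp
  · rw [polylog, mellin, div_eq_mul_inv, mul_comm z, mul_assoc, ← integral_const_mul]
    congr 1
    refine integral_congr_ae (Filter.Eventually.of_forall fun t => ?_)
    simp only [smul_eq_mul]
    ring

theorem differentiableOn_polylog {s : ℂ} (hs : 0 < s.re) :
    DifferentiableOn ℂ (polylog s) {z : ℂ | 1 - z ∈ slitPlane} := by
  have hopen : IsOpen {z : ℂ | 1 - z ∈ slitPlane} :=
    isOpen_slitPlane.preimage (by fun_prop)
  intro z₀ hz₀
  obtain ⟨ε, hε, hball⟩ := Metric.nhds_basis_closedBall.mem_iff.mp (hopen.mem_nhds hz₀)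
  have hne : ∀ u ∈ Icc (0 : ℝ) 1, ∀ z ∈ Metric.closedBall z₀ ε, 1 - (u : ℂ) * z ≠ 0 := by
    intro u hu z hz h
    have hz' : 1 - z ∈ slitPlane := hball hz
    have h1 := congrArg Complex.re h
    have h2 := congrArg Complex.im h
    simp at h1 h2
    rw [mem_slitPlane_iff] at hz'
    simp at hz'
    rcases h2 with h2 | h2
    · simp [h2] at h1
    · rcases hz' with h3 | h3
      · have hu0 : 0 < u := by
          rcases hu.1.eq_or_lt with h0 | h0
          · simp [← h0] at h1
          · exact h0
        nlinarith [hu.2, mul_lt_mul_of_pos_left h3 hu0]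
      · exact h3 h2
  obtain ⟨c, hc, hcb⟩ : ∃ c : ℝ, 0 < c ∧ ∀ u ∈ Icc (0 : ℝ) 1, ∀ z ∈ Metric.closedBall z₀ ε,
      c ≤ ‖1 - (u : ℂ) * z‖ := by
    have hK : IsCompact (Icc (0 : ℝ) 1 ×ˢ Metric.closedBall z₀ ε) :=
      isCompact_Icc.prod (isCompact_closedBall z₀ ε)
    obtain ⟨p, hp, hmin⟩ := hK.exists_isMinOn
      ⟨(0, z₀), ⟨by simp, by simp [hε.le]⟩⟩
      (f := fun p : ℝ × ℂ => ‖1 - (p.1 : ℂ) * p.2‖) (by fun_prop)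
    refine ⟨_, norm_pos_iff.mpr (hne p.1 hp.1 p.2 hp.2), fun u hu z hz => ?_⟩
    exact hmin (show (u, z) ∈ Icc (0 : ℝ) 1 ×ˢ Metric.closedBall z₀ ε from ⟨hu, hz⟩)
  have hlow : ∀ t ∈ Ioi (0 : ℝ), ∀ z ∈ Metric.closedBall z₀ ε,
      c * Real.exp t ≤ ‖Complex.exp t - z‖ := by
    intro t ht z hz
    have h := hcb (Real.exp (-t))
      ⟨(Real.exp_pos _).le, Real.exp_le_one_iff.mpr (by simpa using (le_of_lt ht))⟩ z hz
    have he : Complex.exp t - z = Complex.exp t * (1 - ((Real.exp (-t) : ℝ) : ℂ) * z) := by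
      rw [mul_sub, ← mul_assoc, Complex.ofReal_exp, ← Complex.exp_add]
      simp
    rw [he, norm_mul, Complex.norm_exp, Complex.ofReal_re, mul_comm c]
    gcongr
  have hden : ∀ t ∈ Ioi (0 : ℝ), ∀ z ∈ Metric.closedBall z₀ ε, Complex.exp t - z ≠ 0 := by
    intro t ht z hz
    have := hlow t ht z hz
    have h2 : 0 < c * Real.exp t := by positivity
    exact norm_pos_iff.mp (h2.trans_le this)
  have hmeasF : ∀ z : ℂ, AEStronglyMeasurable
      (fun t : ℝ => (t : ℂ) ^ (s - 1) / (Complex.exp t - z)) (volume.restrict (Ioi 0)) := by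
    intro z
    exact (by fun_prop : Measurable fun t : ℝ =>
      (t : ℂ) ^ (s - 1) / (Complex.exp t - z)).aestronglyMeasurable
  have hint : IntegrableOn (fun t : ℝ => Real.exp (-t) * t ^ (s.re - 1)) (Ioi 0) :=
    Real.GammaIntegral_convergent hs
  have hnum : ∀ t ∈ Ioi (0 : ℝ), ‖(t : ℂ) ^ (s - 1)‖ = t ^ (s.re - 1) := by
    intro t ht
    rw [Complex.norm_cpow_eq_rpow_re_of_pos ht]
    simp
  have hmem : z₀ ∈ Metric.closedBall z₀ ε := Metric.mem_closedBall_self hε.le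
  have hder := hasDerivAt_integral_of_dominated_loc_of_deriv_le
    (μ := volume.restrict (Ioi (0 : ℝ)))
    (F := fun (z : ℂ) (t : ℝ) => (t : ℂ) ^ (s - 1) / (Complex.exp t - z))
    (F' := fun (z : ℂ) (t : ℝ) => (t : ℂ) ^ (s - 1) / (Complex.exp t - z) ^ 2)
    (x₀ := z₀) (s := Metric.closedBall z₀ ε)
    (bound := fun t : ℝ => (c ^ 2)⁻¹ * (Real.exp (-t) * t ^ (s.re - 1)))
    (Metric.closedBall_mem_nhds z₀ hε)
    (Filter.Eventually.of_forall hmeasF)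
    (by
      refine Integrable.mono' (hint.const_mul c⁻¹) (hmeasF z₀) ?_
      refine (ae_restrict_iff' measurableSet_Ioi).mpr (Filter.Eventually.of_forall fun t ht => ?_)
      have ht0 : (0 : ℝ) < t := ht
      rw [norm_div, hnum t ht]
      calc t ^ (s.re - 1) / ‖Complex.exp t - z₀‖ ≤ t ^ (s.re - 1) / (c * Real.exp t) := by
            gcongr
            exact hlow t ht z₀ hmem
        _ = c⁻¹ * (Real.exp (-t) * t ^ (s.re - 1)) := by
            rw [Real.exp_neg]
            field_simp)
    ((by fun_prop : Measurable fun t : ℝ =>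
      (t : ℂ) ^ (s - 1) / (Complex.exp t - z₀) ^ 2).aestronglyMeasurable)
    (by
      refine (ae_restrict_iff' measurableSet_Ioi).mpr
        (Filter.Eventually.of_forall fun t ht z hz => ?_)
      have ht0 : (0 : ℝ) < t := ht
      rw [norm_div, hnum t ht, norm_pow]
      calc t ^ (s.re - 1) / ‖Complex.exp t - z‖ ^ 2
          ≤ t ^ (s.re - 1) / (c ^ 2 * Real.exp t) := by
            gcongr
            have h1 := hlow t ht z hz
            have h2 : (c * Real.exp t) ^ 2 ≤ ‖Complex.exp t - z‖ ^ 2 := by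
              gcongr
            have h3 : 1 ≤ Real.exp t := Real.one_le_exp ht0.le
            have h4 : c ^ 2 * Real.exp t ≤ (c * Real.exp t) ^ 2 := by
              rw [mul_pow]
              gcongr
              nlinarith
            exact h4.trans h2
        _ = (c ^ 2)⁻¹ * (Real.exp (-t) * t ^ (s.re - 1)) := by
            rw [Real.exp_neg]
            field_simp)
    (hint.const_mul _)
    (by
      refine (ae_restrict_iff' measurableSet_Ioi).mpr
        (Filter.Eventually.of_forall fun t ht z hz => ?_)
      have hd : HasDerivAt (fun w : ℂ => Complex.exp t - w) (-1) z := by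
        simpa using (hasDerivAt_id z).const_sub (Complex.exp t)
      have h := (hasDerivAt_const z ((t : ℂ) ^ (s - 1))).div hd (hden t ht z hz)
      convert! h using 1
      ring)
  have h1 : DifferentiableAt ℂ (fun z : ℂ => z / Complex.Gamma s) z₀ := by fun_prop
  exact (h1.mul hder.2.differentiableAt).differentiableWithinAt

/-! Write `M k` for the moment of `x ^ k` against `1 / (1 + x ^ 2)` on `[0, 1]`. The digamma
difference at `(k + 3) / 4` and `(k + 1) / 4` is `4 * M k` (`digamma_sub_digamma_eq_arctanMoment`),
so each series is a sum of shifted moments over squares. Since `M (k + 2) = 1 / (k + 1) - M k`,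
raising the shift by two reverses the sign of the sum and adds a rational series evaluated by `π ^
2` and a harmonic number (`HasSum.arctanMoment_shift`). This produces the finite sums and the
alternating sign of `C`, and leaves one evaluation, the base sum of `M k / k ^ 2` over `k ≥ 1`,
which is `C / 4`.

For the base sum, write `1 / k ^ 2` as the integral of `t * exp (-k t)` and sum the generating
function of the moments. With `x = exp (-t)`, three integrals against `dx / (1 + x ^ 2)` remain:
those of `log x`, of `x * log x`, and of `log x * log (1 - x)`. The first two are values of `Li_2`
at `i`. The third is reduced by `2ab = a ^ 2 + b ^ 2 - (a - b) ^ 2` to the squares of `log x`, `log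
(1 - x)` and `log (x / (1 - x))`.

Substituting `x ↦ 1 - x`, respectively `v = log (x / (1 - x))`, turns the last two squares into
integrals of `v ^ 2 / (2 e ^ v ∓ 2 + e ^ (-v))`, over a half line and over the whole line.
Translation by `log 2 / 2` makes this denominator even, and the whole-line integrals become `Im
Li_3` at eighth roots of unity, known from Bernoulli polynomials. The half-line integral is the
whole-line one minus its left half, which is a multiple of `Im Li_3 (1 + i)`; that value is never
evaluated further. -/

/-! ### Moments and digamma differences. -/

/-- The moments `∫ x in 0..1, x ^ k / (1 + x ^ 2)`, given by their two-step recursion. -/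
noncomputable def arctanMoment : ℕ → ℝ
  | 0 => Real.pi / 4
  | 1 => Real.log 2 / 2
  | k + 2 => 1 / ((k : ℝ) + 1) - arctanMoment k

theorem arctanMoment_add_two (k : ℕ) :
    arctanMoment (k + 2) = 1 / ((k : ℝ) + 1) - arctanMoment k := rfl

/-- Supplies the domination needed for the generating function and for exchanging sum and integral,
using only the recursion. -/
theorem exists_abs_arctanMoment_le : ∃ B : ℝ, ∀ k, |arctanMoment k| ≤ B := by
  obtain ⟨B, hB⟩ : ∃ B : ℝ, ∀ k < 4, |arctanMoment k| + 1 / ((k : ℝ) + 1) ≤ B := by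
    obtain ⟨B, hB⟩ := ((Finset.range 4).image
      fun k => |arctanMoment k| + 1 / ((k : ℝ) + 1)).exists_le
    exact ⟨B, fun k hk => hB _ (Finset.mem_image_of_mem _ (Finset.mem_range.mpr hk))⟩
  -- A single two-step estimate would only give a divergent harmonic bound. Over four steps the
  -- increments `1 / (j + 1) - 1 / (j + 3)` are absorbed by the extra term `1 / (k + 1)`.
  have key : ∀ k, |arctanMoment k| + 1 / ((k : ℝ) + 1) ≤ B := by
    intro k
    induction k using Nat.strong_induction_on with
    | _ k ih =>
      rcases lt_or_ge k 4 with h | h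
      · exact hB k h
      · obtain ⟨j, rfl⟩ := Nat.exists_eq_add_of_le' h
        have h1 := ih j (by omega)
        have h2 : arctanMoment (j + 4)
            = arctanMoment j - (1 / ((j : ℝ) + 1) - 1 / ((j : ℝ) + 3)) := by
          rw [show j + 4 = (j + 2) + 2 from rfl, arctanMoment_add_two, arctanMoment_add_two]
          push_cast
          ring
        have h3 : (0 : ℝ) ≤ 1 / ((j : ℝ) + 1) - 1 / ((j : ℝ) + 3) := by
          rw [sub_nonneg]
          exact one_div_le_one_div_of_le (by positivity) (by linarith)
        have h4 : 1 / (((j + 4 : ℕ) : ℝ) + 1) ≤ 1 / ((j : ℝ) + 3) := by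
          push_cast
          exact one_div_le_one_div_of_le (by positivity) (by linarith)
        have h5 := abs_sub (arctanMoment j) (1 / ((j : ℝ) + 1) - 1 / ((j : ℝ) + 3))
        rw [abs_of_nonneg h3] at h5
        rw [h2]
        linarith
  refine ⟨B, fun k => ?_⟩
  have h1 := key k
  have h2 : (0 : ℝ) ≤ 1 / ((k : ℝ) + 1) := by positivity
  linarith

/-- Differentiate the reflection formula `Γ(z) Γ(1 - z) = π / sin (π z)` at `z = 1 / 4` and compare
the two derivatives. -/
theorem digamma_one_quarter_reflection :
    Complex.digamma (3 / 4) - Complex.digamma (1 / 4) = Real.pi := by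
  have hd : ∀ x : ℂ, 0 < x.re → DifferentiableAt ℂ Complex.Gamma x := by
    intro x hx
    refine Complex.differentiableAt_Gamma x fun m h => ?_
    rw [h] at hx
    simp at hx
    exact absurd hx (not_lt.mpr (by positivity))
  have e1 : (1 : ℂ) - 1 / 4 = 3 / 4 := by norm_num
  have hr1 : (0 : ℝ) < (1 / 4 : ℂ).re := by norm_num
  have hr3 : (0 : ℝ) < (3 / 4 : ℂ).re := by norm_num
  have h1 := (hd (1 / 4) hr1).hasDerivAt
  have h3 : HasDerivAt (fun z : ℂ => Complex.Gamma (1 - z)) (-deriv Complex.Gamma (3 / 4))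
      (1 / 4) := by
    have h := (hd (3 / 4) hr3).hasDerivAt
    rw [← e1] at h
    have := h.comp (1 / 4 : ℂ) ((hasDerivAt_id (1 / 4 : ℂ)).const_sub 1)
    rw [e1] at this
    simpa [Function.comp_def] using this
  have hp := h1.mul h3
  have hs4 : Complex.sin (Real.pi * (1 / 4)) = ((Real.sqrt 2 / 2 : ℝ) : ℂ) := by
    rw [← Real.sin_pi_div_four]
    push_cast
    congr 1
    ring
  have hc4 : Complex.cos (Real.pi * (1 / 4)) = ((Real.sqrt 2 / 2 : ℝ) : ℂ) := by
    rw [← Real.cos_pi_div_four]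
    push_cast
    congr 1
    ring
  have hne : ((Real.sqrt 2 / 2 : ℝ) : ℂ) ≠ 0 := by
    rw [Complex.ofReal_ne_zero]
    positivity
  have hs : HasDerivAt (fun z : ℂ => Complex.sin (Real.pi * z))
      (Complex.cos (Real.pi * (1 / 4)) * Real.pi) (1 / 4) := by
    have h := (Complex.hasDerivAt_sin (Real.pi * (1 / 4))).comp (1 / 4 : ℂ)
      ((hasDerivAt_id (1 / 4 : ℂ)).const_mul (Real.pi : ℂ))
    simpa [Function.comp_def] using h
  have hq := (hasDerivAt_const (1 / 4 : ℂ) (Real.pi : ℂ)).div hs (by rw [hs4]; exact hne)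
  have hfun : (fun z : ℂ => Complex.Gamma z * Complex.Gamma (1 - z))
      = fun z : ℂ => (Real.pi : ℂ) / Complex.sin (Real.pi * z) :=
    funext Complex.Gamma_mul_Gamma_one_sub
  have hu := hp.unique (f := fun z : ℂ => Complex.Gamma z * Complex.Gamma (1 - z))
    (by rw [hfun]; exact hq)
  have hval := Complex.Gamma_mul_Gamma_one_sub (1 / 4)
  rw [hs4, hc4, e1] at *
  have g1 : Complex.Gamma (1 / 4) ≠ 0 := Complex.Gamma_ne_zero_of_re_pos hr1
  have g3 : Complex.Gamma (3 / 4) ≠ 0 := Complex.Gamma_ne_zero_of_re_pos hr3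
  rw [Complex.digamma_def, logDeriv_apply, logDeriv_apply, div_sub_div _ _ g3 g1,
    div_eq_iff (mul_ne_zero g3 g1)]
  rw [mul_comm (Complex.Gamma (3 / 4)) (Complex.Gamma (1 / 4)), hval]
  have h6 : ((0 : ℂ) * ((Real.sqrt 2 / 2 : ℝ) : ℂ)
      - Real.pi * (((Real.sqrt 2 / 2 : ℝ) : ℂ) * Real.pi)) / ((Real.sqrt 2 / 2 : ℝ) : ℂ) ^ 2
      = - (Real.pi * (Real.pi / ((Real.sqrt 2 / 2 : ℝ) : ℂ))) := by
    field_simp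
    ring
  rw [h6] at hu
  linear_combination -hu

/-- Under `k ↦ k + 2` the upper argument moves to `(k + 1) / 4 + 1` and the lower one to `(k + 3) /
4`, so `ψ(z + 1) = ψ(z) + 1 / z` reproduces the recursion of the moments. -/
theorem digamma_sub_digamma_eq_arctanMoment (k : ℕ) :
    Complex.digamma (((k : ℂ) + 3) / 4) - Complex.digamma (((k : ℂ) + 1) / 4)
      = ((4 * arctanMoment k : ℝ) : ℂ) := by
  induction k using Nat.twoStepInduction with
  | zero =>
    have := digamma_one_quarter_reflection
    simp only [CharP.cast_eq_zero, zero_add, this, arctanMoment]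
    push_cast
    ring
  | one =>
    have h1 : (((1 : ℕ) : ℂ) + 3) / 4 = 1 := by norm_num
    have h2 : (((1 : ℕ) : ℂ) + 1) / 4 = 1 / 2 := by norm_num
    rw [h1, h2, Complex.digamma_one, Complex.digamma_one_half]
    simp only [arctanMoment]
    push_cast
    rw [Complex.ofReal_log (by norm_num)]
    push_cast
    ring
  | more k ih _ =>
    have h := Complex.digamma_apply_add_one (((k : ℂ) + 1) / 4) (by
      intro m hm
      have h1 : (0 : ℝ) ≤ k := by positivity
      have h2 : (0 : ℝ) ≤ m := by positivity
      have h3 : (((k : ℂ) + 1) / 4).re = ((k : ℝ) + 1) / 4 := by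
        have : ((k : ℂ) + 1) / 4 = ((((k : ℝ) + 1) / 4 : ℝ) : ℂ) := by push_cast; rfl
        rw [this, Complex.ofReal_re]
      rw [hm] at h3
      simp at h3
      linarith)
    have e1 : (((k + 2 : ℕ) : ℂ) + 3) / 4 = ((k : ℂ) + 1) / 4 + 1 := by push_cast; ring
    have e2 : (((k + 2 : ℕ) : ℂ) + 1) / 4 = ((k : ℂ) + 3) / 4 := by push_cast; ring
    rw [e1, e2, h, arctanMoment_add_two]
    push_cast at ih ⊢
    rw [inv_div]
    linear_combination -ih

/-! ### Shifting the moment index and the resulting finite sums. -/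

theorem hasSum_inv_sub_inv_add (N : ℕ) :
    HasSum (fun k : ℕ => 1 / ((k : ℝ) + 1) - 1 / ((k : ℝ) + 1 + N)) (harmonic N : ℚ) := by
  induction N with
  | zero => simp
  | succ N ih =>
    have h : HasSum (fun k : ℕ => 1 / ((k : ℝ) + 1 + N) - 1 / ((k : ℝ) + 1 + (N + 1)))
        (1 / ((N : ℝ) + 1)) := by
      have hsum : ∀ n, ∑ k ∈ Finset.range n,
          (1 / ((k : ℝ) + 1 + N) - 1 / ((k : ℝ) + 1 + (N + 1)))
            = 1 / ((N : ℝ) + 1) - 1 / ((n : ℝ) + 1 + N) := by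
        intro n
        have := Finset.sum_range_sub' (fun k : ℕ => 1 / ((k : ℝ) + 1 + N)) n
        simp only [Nat.cast_add, Nat.cast_one, Nat.cast_zero, zero_add] at this
        rw [add_comm (N : ℝ) 1, ← this]
        refine Finset.sum_congr rfl fun k _ => ?_
        ring_nf
      rw [hasSum_iff_tendsto_nat_of_nonneg]
      · simp only [hsum]
        have : Filter.Tendsto (fun n : ℕ => 1 / ((n : ℝ) + 1 + N)) Filter.atTop (nhds 0) := by
          simp only [one_div]
          refine Filter.Tendsto.inv_tendsto_atTop ?_
          exact Filter.tendsto_atTop_add_const_right _ _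
            (Filter.tendsto_atTop_add_const_right _ _ tendsto_natCast_atTop_atTop)
        simpa using this.const_sub (1 / ((N : ℝ) + 1))
      · intro k
        rw [sub_nonneg]
        gcongr
        linarith
    have := ih.add h
    rw [harmonic_succ]
    push_cast
    convert! this using 1
    · funext k
      ring
    · rw [one_div]

/-- Partial fractions: with `x = k + 1`, the term is `1 / (N x ^ 2) - (1 / x - 1 / (x + N)) / N ^
2`. -/
theorem hasSum_inv_sq_mul_inv_add {N : ℕ} (hN : N ≠ 0) :
    HasSum (fun k : ℕ => 1 / (((k : ℝ) + 1) ^ 2 * ((k : ℝ) + 1 + N)))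
      (Real.pi ^ 2 / (6 * N) - (harmonic N : ℚ) / (N : ℝ) ^ 2) := by
  have hz : HasSum (fun k : ℕ => 1 / ((k : ℝ) + 1) ^ 2) (Real.pi ^ 2 / 6) := by
    have := (hasSum_nat_add_iff' 1).mpr hasSum_zeta_two
    simpa using this
  have hN' : (N : ℝ) ≠ 0 := by exact_mod_cast hN
  have h := (hz.mul_left (1 / (N : ℝ))).sub
    ((hasSum_inv_sub_inv_add N).mul_left (1 / (N : ℝ) ^ 2))
  convert! h using 1
  · funext k
    have h1 : (k : ℝ) + 1 ≠ 0 := by positivity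
    have h2 : (k : ℝ) + 1 + N ≠ 0 := by positivity
    field_simp
    ring
  · field_simp

theorem HasSum.arctanMoment_shift {N : ℕ} (hN : N ≠ 0) {v : ℝ}
    (h : HasSum (fun k : ℕ => 4 * arctanMoment (k + N) / ((k : ℝ) + 1) ^ 2) v) :
    HasSum (fun k : ℕ => 4 * arctanMoment (k + N + 2) / ((k : ℝ) + 1) ^ 2)
      (4 * (Real.pi ^ 2 / (6 * N) - (harmonic N : ℚ) / (N : ℝ) ^ 2) - v) := by
  convert! ((hasSum_inv_sq_mul_inv_add hN).mul_left 4).sub h using 1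
  funext k
  rw [arctanMoment_add_two]
  push_cast
  have h1 : (k : ℝ) + 1 ≠ 0 := by positivity
  have h2 : (k : ℝ) + 1 + N ≠ 0 := by positivity
  have h3 : (k : ℝ) + N + 1 ≠ 0 := by positivity
  field_simp
  ring

theorem hasSum_arctanMoment_even {c : ℝ}
    (h : HasSum (fun k : ℕ => 4 * arctanMoment (k + 3) / ((k : ℝ) + 1) ^ 2)
      (-4 + 2 / 3 * Real.pi ^ 2 - c)) (m : ℕ) :
    HasSum (fun k : ℕ => 4 * arctanMoment (k + (4 * m + 3)) / ((k : ℝ) + 1) ^ 2)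
      (-4
        - ∑ j ∈ Finset.range m, (8 * (j : ℝ) + 9) / (((j : ℝ) + 1) * (4 * (j : ℝ) + 5) ^ 3)
        + 64 * ∑ j ∈ Finset.range m, ((j : ℝ) + 1) * ((harmonic (4 * j + 3) : ℚ) : ℝ)
            / ((4 * (j : ℝ) + 5) ^ 2 * (4 * (j : ℝ) + 3) ^ 2)
        + (2 / 3 - 4 / 3 * ∑ j ∈ Finset.range m,
            1 / ((4 * (j : ℝ) + 5) * (4 * (j : ℝ) + 3))) * Real.pi ^ 2 - c) := by
  induction m with
  | zero => simpa using h
  | succ m ih =>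
    have h2 := (ih.arctanMoment_shift (by omega)).arctanMoment_shift
      (N := 4 * m + 5) (by omega)
    convert! h2 using 1
    simp only [Finset.sum_range_succ]
    have hh : harmonic (4 * m + 5) = harmonic (4 * m + 3) + ((4 * m + 3 + 1 : ℕ) : ℚ)⁻¹
        + ((4 * m + 4 + 1 : ℕ) : ℚ)⁻¹ := by
      rw [← harmonic_succ, ← harmonic_succ]
    rw [hh]
    push_cast
    generalize ((harmonic (4 * m + 3) : ℚ) : ℝ) = H
    generalize ∑ j ∈ Finset.range m,
      (8 * (j : ℝ) + 9) / (((j : ℝ) + 1) * (4 * (j : ℝ) + 5) ^ 3) = A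
    generalize ∑ j ∈ Finset.range m, ((j : ℝ) + 1) * ((harmonic (4 * j + 3) : ℚ) : ℝ)
      / ((4 * (j : ℝ) + 5) ^ 2 * (4 * (j : ℝ) + 3) ^ 2) = B
    generalize ∑ j ∈ Finset.range m, 1 / ((4 * (j : ℝ) + 5) * (4 * (j : ℝ) + 3)) = C
    have a1 : (m : ℝ) + 1 ≠ 0 := by positivity
    have a2 : 4 * (m : ℝ) + 5 ≠ 0 := by positivity
    have a3 : 4 * (m : ℝ) + 3 ≠ 0 := by positivity
    have e1 : 4 * (m : ℝ) + 3 + 1 = 4 * (m + 1) := by ring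
    have e2 : 4 * (m : ℝ) + 4 + 1 = 4 * m + 5 := by ring
    rw [e1, e2]
    -- Two shifts restore the sign: the increment of the closed form is the contribution of `N = 4 m
    -- + 5` minus that of `N = 4 m + 3`.
    have hk :
      -(8 * (m : ℝ) + 9) / ((m + 1) * (4 * m + 5) ^ 3)
        + 64 * ((m + 1) * H / ((4 * m + 5) ^ 2 * (4 * m + 3) ^ 2))
        - 4 / 3 * (1 / ((4 * m + 5) * (4 * m + 3))) * Real.pi ^ 2
      = 4 * (Real.pi ^ 2 / (6 * (4 * m + 5))
          - (H + (4 * ((m : ℝ) + 1))⁻¹ + (4 * (m : ℝ) + 5)⁻¹) / (4 * m + 5) ^ 2)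
        - 4 * (Real.pi ^ 2 / (6 * (4 * m + 3)) - H / (4 * m + 3) ^ 2) := by
      field_simp
      ring
    linear_combination hk

theorem hasSum_arctanMoment_odd {c : ℝ}
    (h : HasSum (fun k : ℕ => 4 * arctanMoment (k + 5) / ((k : ℝ) + 1) ^ 2)
      (86 / 27 - 4 / 9 * Real.pi ^ 2 + c)) (m : ℕ) :
    HasSum (fun k : ℕ => 4 * arctanMoment (k + (4 * m + 5)) / ((k : ℝ) + 1) ^ 2)
      (86 / 27
        - 2 * ∑ j ∈ Finset.Icc 1 m,
            (8 * (j : ℝ) + 5) / ((2 * (j : ℝ) + 1) * (4 * (j : ℝ) + 3) ^ 3)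
        + 32 * ∑ j ∈ Finset.Icc 1 m, (2 * (j : ℝ) + 1) * ((harmonic (4 * j + 1) : ℚ) : ℝ)
            / ((4 * (j : ℝ) + 3) ^ 2 * (4 * (j : ℝ) + 1) ^ 2)
        - (4 / 9 + 4 / 3 * ∑ j ∈ Finset.Icc 1 m,
            1 / ((4 * (j : ℝ) + 3) * (4 * (j : ℝ) + 1))) * Real.pi ^ 2 + c) := by
  induction m with
  | zero => simpa using h
  | succ m ih =>
    have h2 := (ih.arctanMoment_shift (by omega)).arctanMoment_shift
      (N := 4 * m + 7) (by omega)
    convert! h2 using 1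
    simp only [Finset.sum_Icc_succ_top (Nat.le_add_left 1 m)]
    have hh : harmonic (4 * m + 7) = harmonic (4 * m + 5) + ((4 * m + 5 + 1 : ℕ) : ℚ)⁻¹
        + ((4 * m + 6 + 1 : ℕ) : ℚ)⁻¹ := by
      rw [← harmonic_succ, ← harmonic_succ]
    rw [hh, show 4 * (m + 1) + 1 = 4 * m + 5 from rfl]
    push_cast
    generalize ((harmonic (4 * m + 5) : ℚ) : ℝ) = H
    generalize ∑ j ∈ Finset.Icc 1 m,
      (8 * (j : ℝ) + 5) / ((2 * (j : ℝ) + 1) * (4 * (j : ℝ) + 3) ^ 3) = A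
    generalize ∑ j ∈ Finset.Icc 1 m, (2 * (j : ℝ) + 1) * ((harmonic (4 * j + 1) : ℚ) : ℝ)
      / ((4 * (j : ℝ) + 3) ^ 2 * (4 * (j : ℝ) + 1) ^ 2) = B
    generalize ∑ j ∈ Finset.Icc 1 m, 1 / ((4 * (j : ℝ) + 3) * (4 * (j : ℝ) + 1)) = C
    have a1 : 2 * (m : ℝ) + 3 ≠ 0 := by positivity
    have a2 : 4 * (m : ℝ) + 5 ≠ 0 := by positivity
    have a3 : 4 * (m : ℝ) + 7 ≠ 0 := by positivity
    have e1 : 4 * (m : ℝ) + 5 + 1 = 2 * (2 * m + 3) := by ring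
    have e2 : 4 * (m : ℝ) + 6 + 1 = 4 * m + 7 := by ring
    have e3 : 4 * ((m : ℝ) + 1) + 3 = 4 * m + 7 := by ring
    have e4 : 4 * ((m : ℝ) + 1) + 1 = 4 * m + 5 := by ring
    have e5 : 2 * ((m : ℝ) + 1) + 1 = 2 * m + 3 := by ring
    rw [e1, e2, e3, e4, e5]
    -- As in the even case, now with `N = 4 m + 7` minus `N = 4 m + 5`.
    have hk :
      -2 * ((8 * ((m : ℝ) + 1) + 5) / ((2 * m + 3) * (4 * m + 7) ^ 3))
        + 32 * ((2 * m + 3) * H / ((4 * m + 7) ^ 2 * (4 * m + 5) ^ 2))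
        - 4 / 3 * (1 / ((4 * m + 7) * (4 * m + 5))) * Real.pi ^ 2
      = 4 * (Real.pi ^ 2 / (6 * (4 * m + 7))
          - (H + (2 * (2 * (m : ℝ) + 3))⁻¹ + (4 * (m : ℝ) + 7)⁻¹) / (4 * m + 7) ^ 2)
        - 4 * (Real.pi ^ 2 / (6 * (4 * m + 5)) - H / (4 * m + 5) ^ 2) := by
      field_simp
      ring
    linear_combination hk

/-! ### Real and imaginary parts of the Bose-Einstein integral. -/

/-- `|e ^ t - z| ^ 2 / e ^ t`, the denominator of the real and imaginary parts of the
Bose-Einstein kernel. -/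
noncomputable def boseDenom (z : ℂ) (t : ℝ) : ℝ :=
  Real.exp t - 2 * z.re + normSq z * Real.exp (-t)

theorem normSq_exp_sub (z : ℂ) (t : ℝ) :
    normSq (Complex.exp t - z) = Real.exp t * boseDenom z t := by
  have h : Real.exp t * Real.exp (-t) = 1 := by rw [← Real.exp_add]; simp
  rw [boseDenom, ← Complex.ofReal_exp, normSq_apply]
  simp only [sub_re, ofReal_re, sub_im, ofReal_im, normSq_apply]
  linear_combination -(z.re * z.re + z.im * z.im) * h

/-- The minimum of `|1 - u z|` over real `u` is `|Im z| / |z|`; take `u = exp (-t)`. This gives both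
positivity of `boseDenom` and integrability of the kernel. -/
theorem normSq_exp_sub_ge (z : ℂ) (hz : z.im ≠ 0) (t : ℝ) :
    z.im ^ 2 / normSq z * Real.exp t ^ 2 ≤ normSq (Complex.exp t - z) := by
  have hn : 0 < normSq z := normSq_pos.mpr fun h => hz (by simp [h])
  rw [div_mul_eq_mul_div, div_le_iff₀ hn, ← Complex.ofReal_exp]
  simp only [normSq_apply, sub_re, ofReal_re, sub_im, ofReal_im]
  nlinarith [sq_nonneg (z.re * Real.exp t - (z.re * z.re + z.im * z.im))]

theorem boseDenom_pos {z : ℂ} (hz : z.im ≠ 0) (t : ℝ) : 0 < boseDenom z t := by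
  have h := normSq_exp_sub_ge z hz t
  have hn : 0 < normSq z := normSq_pos.mpr fun h => hz (by simp [h])
  have h2 : 0 < z.im ^ 2 / normSq z * Real.exp t ^ 2 := by positivity
  rw [normSq_exp_sub] at h
  exact pos_of_mul_pos_right (h2.trans_le h) (Real.exp_pos t).le

theorem integrableOn_pow_mul_exp_neg (n : ℕ) :
    IntegrableOn (fun t : ℝ => t ^ n * Real.exp (-t)) (Ioi 0) := by
  have h := Real.GammaIntegral_convergent (s := (n : ℝ) + 1) (by positivity)
  refine h.congr_fun (fun t _ => ?_) measurableSet_Ioi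
  simp [mul_comm]

theorem integrableOn_pow_div_exp_sub (n : ℕ) {z : ℂ} (hz : z.im ≠ 0) :
    IntegrableOn (fun t : ℝ => (t : ℂ) ^ n / (Complex.exp t - z)) (Ioi 0) := by
  have hn : 0 < normSq z := normSq_pos.mpr fun h => hz (by simp [h])
  set c := Real.sqrt (z.im ^ 2 / normSq z) with hc
  have hc0 : 0 < c := by positivity
  refine Integrable.mono' ((integrableOn_pow_mul_exp_neg n).const_mul c⁻¹)
    (by fun_prop : Measurable fun t : ℝ => (t : ℂ) ^ n / (Complex.exp t - z)).aestronglyMeasurable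
    ((ae_restrict_iff' measurableSet_Ioi).mpr (Filter.Eventually.of_forall fun t ht => ?_))
  have ht0 : (0 : ℝ) < t := ht
  have hlow : c * Real.exp t ≤ ‖Complex.exp t - z‖ := by
    rw [← abs_of_pos (show 0 < c * Real.exp t by positivity),
      ← abs_of_nonneg (norm_nonneg (Complex.exp t - z)), ← sq_le_sq, ← normSq_eq_norm_sq, mul_pow,
      hc, Real.sq_sqrt (by positivity)]
    exact normSq_exp_sub_ge z hz t
  rw [norm_div, norm_pow, Complex.norm_real, Real.norm_eq_abs, abs_of_pos ht0]
  calc t ^ n / ‖Complex.exp t - z‖ ≤ t ^ n / (c * Real.exp t) := by gcongr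
    _ = c⁻¹ * (t ^ n * Real.exp (-t)) := by
      rw [Real.exp_neg]
      field_simp

theorem polylog_natCast_add_one (n : ℕ) (z : ℂ) :
    polylog (n + 1) z
      = z / (n.factorial : ℂ) * ∫ t in Ioi (0 : ℝ), (t : ℂ) ^ n / (Complex.exp t - z) := by
  simp only [polylog, Complex.Gamma_nat_eq_factorial, add_sub_cancel_right, cpow_natCast]

theorem mul_pow_div_exp_sub (n : ℕ) (z : ℂ) (t : ℝ) (hz : z.im ≠ 0) :
    z * ((t : ℂ) ^ n / (Complex.exp t - z))
      = ((t ^ n * ((z.re - normSq z * Real.exp (-t)) / boseDenom z t) : ℝ) : ℂ)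
        + ((z.im * (t ^ n / boseDenom z t) : ℝ) : ℂ) * I := by
  have hd := (boseDenom_pos hz t).ne'
  have he := (Real.exp_pos t).ne'
  have hinv : z * ((t : ℂ) ^ n / (Complex.exp t - z))
      = ((t ^ n / (Real.exp t * boseDenom z t) : ℝ) : ℂ)
        * (z * (starRingEnd ℂ) (Complex.exp t - z)) := by
    rw [div_eq_mul_inv, inv_def, normSq_exp_sub]
    push_cast
    ring
  have hconj : z * (starRingEnd ℂ) (Complex.exp t - z)
      = ((z.re * Real.exp t - normSq z : ℝ) : ℂ) + ((z.im * Real.exp t : ℝ) : ℂ) * I := by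
    rw [map_sub, mul_sub, mul_conj, ← Complex.ofReal_exp, conj_ofReal]
    nth_rw 1 [← re_add_im z]
    push_cast
    ring
  have h1 : t ^ n * ((z.re - normSq z * Real.exp (-t)) / boseDenom z t)
      = t ^ n / (Real.exp t * boseDenom z t) * (z.re * Real.exp t - normSq z) := by
    rw [Real.exp_neg]
    field_simp
  have h2 : z.im * (t ^ n / boseDenom z t)
      = t ^ n / (Real.exp t * boseDenom z t) * (z.im * Real.exp t) := by
    field_simp
  rw [hinv, hconj, h1, h2]
  push_cast
  ring

theorem integrableOn_pow_div_boseDenom (n : ℕ) {z : ℂ} (hz : z.im ≠ 0) :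
    IntegrableOn (fun t : ℝ => t ^ n / boseDenom z t) (Ioi 0) := by
  have h := (((integrableOn_pow_div_exp_sub n hz).const_mul z).im).const_mul z.im⁻¹
  refine h.congr (Filter.Eventually.of_forall fun t => ?_)
  simp only [mul_pow_div_exp_sub n z t hz, RCLike.im_eq_complex_im, add_im, ofReal_im, mul_im,
    ofReal_re, I_im, I_re]
  field_simp
  ring

theorem im_polylog_eq_integral (n : ℕ) {z : ℂ} (hz : z.im ≠ 0) :
    (polylog (n + 1) z).im
      = z.im / n.factorial * ∫ t in Ioi (0 : ℝ), t ^ n / boseDenom z t := by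
  have h := integral_im ((integrableOn_pow_div_exp_sub n hz).const_mul z)
  rw [polylog_natCast_add_one, div_mul_eq_mul_div, ← integral_const_mul,
    ← Complex.ofReal_natCast, div_ofReal_im]
  rw [RCLike.im_eq_complex_im] at h
  rw [← h, div_mul_eq_mul_div, ← integral_const_mul]
  congr 1
  refine integral_congr_ae (Filter.Eventually.of_forall fun t => ?_)
  simp [mul_pow_div_exp_sub n z t hz, -ofReal_mul, -ofReal_div]

theorem re_polylog_eq_integral (n : ℕ) {z : ℂ} (hz : z.im ≠ 0) :
    (polylog (n + 1) z).re = (∫ t in Ioi (0 : ℝ),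
      t ^ n * ((z.re - normSq z * Real.exp (-t)) / boseDenom z t)) / n.factorial := by
  have h := integral_re ((integrableOn_pow_div_exp_sub n hz).const_mul z)
  rw [polylog_natCast_add_one, div_mul_eq_mul_div, ← integral_const_mul,
    ← Complex.ofReal_natCast, div_ofReal_re]
  rw [RCLike.re_eq_complex_re] at h
  rw [← h]
  congr 1
  refine integral_congr_ae (Filter.Eventually.of_forall fun t => ?_)
  simp [mul_pow_div_exp_sub n z t hz, -ofReal_mul, -ofReal_div]

/-! ### Polylogarithm values on the unit circle. -/

theorem hasSum_polylog_exp {n : ℕ} (hn : n ≠ 0) (x : ℝ) :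
    HasSum (fun k : ℕ => Complex.exp ((2 * Real.pi * k * x : ℝ) * I) / (k : ℂ) ^ (n + 1))
      (polylog (n + 1) (Complex.exp ((2 * Real.pi * x : ℝ) * I))) := by
  have h := hasSum_polylog (s := n + 1) (z := Complex.exp ((2 * Real.pi * x : ℝ) * I))
    (by simpa using Nat.pos_of_ne_zero hn) (by rw [norm_exp_ofReal_mul_I])
  -- Starting the sum at `k = 0`, as the Fourier series of Bernoulli polynomials do, is harmless:
  -- that term is a division by zero, hence `0`.
  refine (hasSum_nat_add_iff' 1).mp ?_
  simp only [Finset.sum_range_one, CharP.cast_eq_zero]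
  rw [zero_pow (by omega), div_zero, sub_zero]
  convert! h using 1
  funext k
  rw [← Complex.exp_nat_mul]
  norm_cast
  congr 2
  push_cast
  ring

theorem im_polylog_three_exp {x : ℝ} (hx : x ∈ Icc (0 : ℝ) 1) :
    (polylog 3 (Complex.exp ((2 * Real.pi * x : ℝ) * I))).im
      = 2 * Real.pi ^ 3 / 3 * (x ^ 3 - 3 / 2 * x ^ 2 + x / 2) := by
  have h1 := Complex.hasSum_im (hasSum_polylog_exp (n := 2) two_ne_zero x)
  have h2 := hasSum_one_div_nat_pow_mul_sin (k := 1) one_ne_zero hx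
  have e : (((2 : ℕ) : ℂ) + 1) = 3 := by norm_num
  rw [e] at h1
  have h3 : HasSum (fun k : ℕ => 1 / (k : ℝ) ^ (2 * 1 + 1) * Real.sin (2 * Real.pi * k * x))
      (polylog 3 (Complex.exp ((2 * Real.pi * x : ℝ) * I))).im := by
    convert! h1 using 1
    funext k
    rw [← Complex.ofReal_natCast, ← Complex.ofReal_pow, div_ofReal_im, exp_ofReal_mul_I_im]
    ring
  rw [h3.unique h2]
  simp only [Polynomial.bernoulli, Finset.sum_range_succ, Finset.sum_range_zero,
    Polynomial.map_add, Polynomial.eval_add, Polynomial.map_monomial, Polynomial.eval_monomial]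
  rw [_root_.bernoulli_one, bernoulli_eq_bernoulli'_of_ne_one zero_ne_one, bernoulli'_zero,
    bernoulli_eq_bernoulli'_of_ne_one (by decide : 2 ≠ 1), bernoulli'_two,
    bernoulli_eq_bernoulli'_of_ne_one (by decide : 3 ≠ 1), bernoulli'_three]
  norm_num [Nat.factorial, Nat.choose]
  ring

theorem re_polylog_two_exp {x : ℝ} (hx : x ∈ Icc (0 : ℝ) 1) :
    (polylog 2 (Complex.exp ((2 * Real.pi * x : ℝ) * I))).re
      = Real.pi ^ 2 * (x ^ 2 - x + 1 / 6) := by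
  have h1 := Complex.hasSum_re (hasSum_polylog_exp (n := 1) one_ne_zero x)
  have h2 := hasSum_one_div_nat_pow_mul_cos (k := 1) one_ne_zero hx
  have e : (((1 : ℕ) : ℂ) + 1) = 2 := by norm_num
  rw [e] at h1
  have h3 : HasSum (fun k : ℕ => 1 / (k : ℝ) ^ (2 * 1) * Real.cos (2 * Real.pi * k * x))
      (polylog 2 (Complex.exp ((2 * Real.pi * x : ℝ) * I))).re := by
    convert! h1 using 1
    funext k
    rw [← Complex.ofReal_natCast, ← Complex.ofReal_pow, div_ofReal_re, exp_ofReal_mul_I_re]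
    ring
  rw [h3.unique h2]
  simp only [Polynomial.bernoulli, Finset.sum_range_succ, Finset.sum_range_zero,
    Polynomial.map_add, Polynomial.eval_add, Polynomial.map_monomial, Polynomial.eval_monomial]
  rw [_root_.bernoulli_one, bernoulli_eq_bernoulli'_of_ne_one zero_ne_one, bernoulli'_zero,
    bernoulli_eq_bernoulli'_of_ne_one (by decide : 2 ≠ 1), bernoulli'_two]
  norm_num [Nat.factorial, Nat.choose]
  ring

theorem im_polylog_two_I : (polylog 2 I).im = catalanConst := by
  have h := Complex.hasSum_im (hasSum_polylog (s := 2) (z := I) (by norm_num) (by simp))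
  have hinj : Function.Injective fun k : ℕ => 2 * k := fun a b h => by simpa using h
  have hI : ∀ j : ℕ, I ^ (2 * j) = (((-1 : ℝ) ^ j : ℝ) : ℂ) := fun j => by
    rw [pow_mul, I_sq]
    push_cast
    rfl
  have hcast : ∀ k : ℕ, ((k : ℂ) + 1) ^ (2 : ℂ) = ((((k : ℝ) + 1) ^ 2 : ℝ) : ℂ) := fun k => by
    rw [cpow_ofNat]
    push_cast
    rfl
  simp only [hcast, div_ofReal_im] at h
  -- Only even `k` contribute: for odd `k` the power `I ^ (k + 1)` is real.
  rw [← hinj.hasSum_iff] at h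
  · rw [catalanConst, ← h.tsum_eq]
    congr 1
    funext k
    simp only [Function.comp_apply]
    rw [pow_succ, hI, im_ofReal_mul, I_im]
    push_cast
    ring
  · intro k hk
    obtain ⟨j, rfl | rfl⟩ := k.even_or_odd'
    · exact absurd ⟨j, rfl⟩ hk
    · rw [show 2 * j + 1 + 1 = 2 * (j + 1) from rfl, hI, ofReal_im, zero_div]

/-! ### Integrals with a skewed hyperbolic denominator. -/

/-- The denominator `2 e ^ v + 2 κ + e ^ (-v)`. -/
noncomputable def skewCoshDenom (κ v : ℝ) : ℝ :=
  2 * Real.exp v + 2 * κ + Real.exp (-v)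

theorem skewCoshDenom_eq_two_mul_boseDenom {κ : ℝ} (hκ : κ ^ 2 = 1) (v : ℝ) :
    skewCoshDenom κ v = 2 * boseDenom ⟨-κ / 2, 1 / 2⟩ v := by
  simp only [skewCoshDenom, boseDenom, normSq_mk]
  linear_combination -Real.exp (-v) / 2 * hκ

theorem skewCoshDenom_neg {κ : ℝ} (hκ : κ ^ 2 = 1) (v : ℝ) :
    skewCoshDenom κ (-v) = boseDenom ⟨-κ, 1⟩ v := by
  simp only [skewCoshDenom, boseDenom, normSq_mk, neg_neg]
  linear_combination -Real.exp (-v) * hκ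

theorem skewCoshDenom_pos {κ : ℝ} (hκ : κ ^ 2 = 1) (v : ℝ) : 0 < skewCoshDenom κ v := by
  rw [skewCoshDenom_eq_two_mul_boseDenom hκ]
  exact mul_pos two_pos (boseDenom_pos (by simp) v)

theorem integrableOn_Ioi_pow_div_skewCoshDenom (n : ℕ) {κ : ℝ} (hκ : κ ^ 2 = 1) :
    IntegrableOn (fun v : ℝ => v ^ n / skewCoshDenom κ v) (Ioi 0) := by
  have h := (integrableOn_pow_div_boseDenom n (z := ⟨-κ / 2, 1 / 2⟩) (by simp)).const_mul 2⁻¹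
  refine h.congr (Filter.Eventually.of_forall fun t => ?_)
  simp only [skewCoshDenom_eq_two_mul_boseDenom hκ]
  have := (boseDenom_pos (z := ⟨-κ / 2, 1 / 2⟩) (by simp) t).ne'
  field_simp

theorem integrableOn_Iic_pow_div_skewCoshDenom (n : ℕ) {κ : ℝ} (hκ : κ ^ 2 = 1) :
    IntegrableOn (fun v : ℝ => v ^ n / skewCoshDenom κ v) (Iic 0) := by
  rw [integrableOn_Iic_iff_integrableOn_Iio]
  have h := ((integrableOn_pow_div_boseDenom n (z := ⟨-κ, 1⟩) (by simp)).comp_neg).const_mul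
    ((-1) ^ n)
  rw [neg_Ioi, neg_zero] at h
  refine h.congr (Filter.Eventually.of_forall fun t => ?_)
  simp only [← skewCoshDenom_neg hκ, neg_neg]
  rw [← mul_div_assoc, ← mul_pow, neg_one_mul, neg_neg]

theorem integrable_pow_div_skewCoshDenom (n : ℕ) {κ : ℝ} (hκ : κ ^ 2 = 1) :
    Integrable (fun v : ℝ => v ^ n / skewCoshDenom κ v) := by
  rw [← integrableOn_univ, ← Iic_union_Ioi (a := (0 : ℝ))]
  exact (integrableOn_Iic_pow_div_skewCoshDenom n hκ).union
    (integrableOn_Ioi_pow_div_skewCoshDenom n hκ)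

theorem integral_one_div_skewCoshDenom {κ : ℝ} (hκ : κ ^ 2 = 1) :
    ∫ v : ℝ, 1 / skewCoshDenom κ v = Real.pi / 2 - Real.arctan κ := by
  have hint : Integrable fun v : ℝ => 1 / skewCoshDenom κ v := by
    simpa using integrable_pow_div_skewCoshDenom 0 hκ
  -- The substitution `u = 2 e ^ v + κ` gives `du / (1 + u ^ 2)`, because `κ ^ 2 = 1`.
  refine integral_of_hasDerivAt_of_tendsto (f := fun v => Real.arctan (2 * Real.exp v + κ))
    (fun v => ?_) hint ?_ ?_
  · have h := (((Real.hasDerivAt_exp v).const_mul 2).add_const κ).arctan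
    convert! h using 1
    have h1 := (skewCoshDenom_pos hκ v).ne'
    have h2 : 1 + (2 * Real.exp v + κ) ^ 2 ≠ 0 := by positivity
    have h3 : Real.exp v * Real.exp (-v) = 1 := by rw [← Real.exp_add]; simp
    rw [one_div_mul_eq_div, div_eq_div_iff h1 h2, skewCoshDenom]
    linear_combination hκ - 2 * h3
  · have h : Filter.Tendsto (fun v : ℝ => 2 * Real.exp v + κ) Filter.atBot
        (nhds (2 * 0 + κ)) := (Real.tendsto_exp_atBot.const_mul 2).add_const κ
    rw [mul_zero, zero_add] at h
    exact (Real.continuous_arctan.tendsto κ).comp h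
  · refine (Real.tendsto_arctan_atTop.mono_right nhdsWithin_le_nhds).comp ?_
    exact Filter.tendsto_atTop_add_const_right _ _
      (Real.tendsto_exp_atTop.const_mul_atTop two_pos)

theorem skewCoshDenom_sub_log {κ : ℝ} {z : ℂ} (hre : z.re = -κ * (Real.sqrt 2 / 2))
    (hz : normSq z = 1) (w : ℝ) :
    skewCoshDenom κ (w - Real.log 2 / 2) = Real.sqrt 2 * boseDenom z w := by
  have hs : Real.exp (Real.log 2 / 2) = Real.sqrt 2 := by
    rw [Real.exp_half, Real.exp_log two_pos]
  have h2 : Real.sqrt 2 * Real.sqrt 2 = 2 := Real.mul_self_sqrt (by norm_num)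
  have hs0 : Real.sqrt 2 ≠ 0 := by positivity
  rw [skewCoshDenom, boseDenom, hre, hz, neg_sub, Real.exp_sub, Real.exp_sub, hs, Real.exp_neg]
  have := (Real.exp_pos w).ne'
  field_simp
  linear_combination -(κ * Real.exp w * Real.sqrt 2 + Real.exp w ^ 2) * h2

/-- Translation by `log 2 / 2` turns the denominator into `√2 * boseDenom z`, which is even because
`|z| = 1`. Evenness kills the linear term of the translated square and halves the line to the
integral for `Im Li_3 z`. -/
theorem integral_sq_div_skewCoshDenom {κ : ℝ} (hκ : κ ^ 2 = 1) {z : ℂ}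
    (hre : z.re = -κ * (Real.sqrt 2 / 2)) (him : z.im = Real.sqrt 2 / 2) :
    ∫ v : ℝ, v ^ 2 / skewCoshDenom κ v
      = 4 * (polylog 3 z).im + Real.log 2 ^ 2 / 4 * (Real.pi / 2 - Real.arctan κ) := by
  have h2 : Real.sqrt 2 * Real.sqrt 2 = 2 := Real.mul_self_sqrt (by norm_num)
  have hs0 : 0 < Real.sqrt 2 := by positivity
  have hz : normSq z = 1 := by
    rw [normSq_apply, hre, him]
    linear_combination (1 / 4 + κ ^ 2 / 4) * h2 + hκ / 2
  have hzi : z.im ≠ 0 := by rw [him]; positivity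
  set a := Real.log 2 / 2 with ha
  have hb : ∀ w, boseDenom z (-w) = boseDenom z w := fun w => by
    simp only [boseDenom, hz, neg_neg]
    ring
  have hshift : ∀ w, skewCoshDenom κ (w - a) = Real.sqrt 2 * boseDenom z w :=
    skewCoshDenom_sub_log hre hz
  have hsq := integrable_pow_div_skewCoshDenom 2 hκ
  have hone : Integrable fun v : ℝ => 1 / skewCoshDenom κ v := by
    simpa using integrable_pow_div_skewCoshDenom 0 hκ
  have g1 := hsq.comp_sub_right a
  have g2 := g1.comp_neg
  have g0 := hone.comp_sub_right a
  have i1 := integral_sub_right_eq_self (μ := volume)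
    (fun v : ℝ => v ^ 2 / skewCoshDenom κ v) a
  have i2 := integral_neg_eq_self (μ := volume)
    (fun v : ℝ => (v - a) ^ 2 / skewCoshDenom κ (v - a))
  have i0 := integral_sub_right_eq_self (μ := volume) (fun v : ℝ => 1 / skewCoshDenom κ v) a
  -- Average over `w ↦ -w`: `w ^ 2 = ((w - a) ^ 2 + (-w - a) ^ 2) / 2 - a ^ 2`.
  have key : ∫ w : ℝ, w ^ 2 / (Real.sqrt 2 * boseDenom z w)
      = (1 / 2) * ((∫ v : ℝ, v ^ 2 / skewCoshDenom κ v) + ∫ v : ℝ, v ^ 2 / skewCoshDenom κ v)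
        - a ^ 2 * ∫ v : ℝ, 1 / skewCoshDenom κ v := by
    nth_rw 2 [← i1]
    rw [← i2, ← i1, ← i0, ← integral_add g1 g2, ← integral_const_mul, ← integral_const_mul]
    refine Eq.trans ?_ (integral_sub ((g1.add g2).const_mul (1 / 2)) (g0.const_mul (a ^ 2)))
    refine integral_congr_ae (Filter.Eventually.of_forall fun w => ?_)
    simp only [hshift, hb]
    ring
  have habs : ∫ w : ℝ, w ^ 2 / (Real.sqrt 2 * boseDenom z w)
      = 2 * ∫ w in Ioi (0 : ℝ), w ^ 2 / (Real.sqrt 2 * boseDenom z w) := by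
    rw [← integral_comp_abs]
    refine integral_congr_ae (Filter.Eventually.of_forall fun w => ?_)
    rcases abs_choice w with h | h <;> simp [h, hb]
  have hpoly := im_polylog_eq_integral 2 hzi
  have e : (((2 : ℕ) : ℂ) + 1) = 3 := by norm_num
  rw [e, him] at hpoly
  have hc : ∫ w in Ioi (0 : ℝ), w ^ 2 / (Real.sqrt 2 * boseDenom z w)
      = 1 / Real.sqrt 2 * ∫ w in Ioi (0 : ℝ), w ^ 2 / boseDenom z w := by
    rw [← integral_const_mul]
    refine integral_congr_ae (Filter.Eventually.of_forall fun w => ?_)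
    simp only
    rw [div_mul_div_comm, one_mul]
  rw [habs, hc, integral_one_div_skewCoshDenom hκ] at key
  have hpoly' : 1 / Real.sqrt 2 * ∫ w in Ioi (0 : ℝ), w ^ 2 / boseDenom z w
      = 2 * (polylog 3 z).im := by
    rw [hpoly]
    norm_num [Nat.factorial]
    field_simp
    linear_combination (-(∫ w in Ioi (0 : ℝ), w ^ 2 / boseDenom z w)) * h2
  rw [hpoly'] at key
  rw [ha] at key
  linear_combination -key

theorem integral_sq_div_skewCoshDenom_one :
    ∫ v : ℝ, v ^ 2 / skewCoshDenom 1 v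
      = 5 * Real.pi ^ 3 / 64 + Real.pi * Real.log 2 ^ 2 / 16 := by
  have e : 2 * Real.pi * (3 / 8) = Real.pi - Real.pi / 4 := by ring
  rw [integral_sq_div_skewCoshDenom (κ := 1) (by norm_num)
      (z := Complex.exp ((2 * Real.pi * (3 / 8) : ℝ) * I))
      (by rw [exp_ofReal_mul_I_re, e, Real.cos_pi_sub, Real.cos_pi_div_four]; ring)
      (by rw [exp_ofReal_mul_I_im, e, Real.sin_pi_sub, Real.sin_pi_div_four]),
    im_polylog_three_exp (by norm_num), Real.arctan_one]
  ring

theorem integral_sq_div_skewCoshDenom_neg_one :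
    ∫ v : ℝ, v ^ 2 / skewCoshDenom (-1) v
      = 7 * Real.pi ^ 3 / 64 + 3 * Real.pi * Real.log 2 ^ 2 / 16 := by
  have e : 2 * Real.pi * (1 / 8) = Real.pi / 4 := by ring
  rw [integral_sq_div_skewCoshDenom (κ := -1) (by norm_num)
      (z := Complex.exp ((2 * Real.pi * (1 / 8) : ℝ) * I))
      (by rw [exp_ofReal_mul_I_re, e, Real.cos_pi_div_four]; ring)
      (by rw [exp_ofReal_mul_I_im, e, Real.sin_pi_div_four]),
    im_polylog_three_exp (by norm_num), Real.arctan_neg, Real.arctan_one]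
  ring

/-- Subtract the negative half line from the whole line; after reflection the former has denominator
`boseDenom (1 + I)`. This is where `Li_3 (1 + i)` enters. -/
theorem integral_Ioi_sq_div_skewCoshDenom_neg_one :
    ∫ v in Ioi (0 : ℝ), v ^ 2 / skewCoshDenom (-1) v
      = 7 * Real.pi ^ 3 / 64 + 3 * Real.pi * Real.log 2 ^ 2 / 16 - 2 * (polylog 3 (1 + I)).im := by
  have h := intervalIntegral.integral_Iic_add_Ioi
    (integrableOn_Iic_pow_div_skewCoshDenom 2 (κ := -1) (by norm_num))
    (integrableOn_Ioi_pow_div_skewCoshDenom 2 (κ := -1) (by norm_num))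
  have hneg := integral_comp_neg_Iic (0 : ℝ) fun v => v ^ 2 / skewCoshDenom (-1) (-v)
  simp only [neg_neg, neg_zero, neg_sq] at hneg
  have hpoly := im_polylog_eq_integral 2 (z := 1 + I) (by simp)
  have e : (((2 : ℕ) : ℂ) + 1) = 3 := by norm_num
  have ez : (⟨- -1, 1⟩ : ℂ) = 1 + I := by apply Complex.ext <;> simp
  rw [e] at hpoly
  rw [hneg, integral_sq_div_skewCoshDenom_neg_one] at h
  simp only [skewCoshDenom_neg (κ := -1) (by norm_num), ez] at h
  simp [Nat.factorial] at hpoly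
  linarith

/-! ### Changes of variable in the logarithmic integrals. -/

/-- The involution `t ↦ -log (1 - e ^ (-t))` of `(0, ∞)`, i.e. `x ↦ 1 - x` in the
coordinate `x = e ^ (-t)`. -/
noncomputable def expReflect (t : ℝ) : ℝ := -Real.log (1 - Real.exp (-t))

theorem one_sub_exp_neg_pos {t : ℝ} (ht : 0 < t) : 0 < 1 - Real.exp (-t) := by
  rw [sub_pos, Real.exp_lt_one_iff]
  linarith

theorem exp_neg_expReflect {t : ℝ} (ht : 0 < t) :
    Real.exp (-expReflect t) = 1 - Real.exp (-t) := by
  rw [expReflect, neg_neg, Real.exp_log (one_sub_exp_neg_pos ht)]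

theorem expReflect_pos {t : ℝ} (ht : 0 < t) : 0 < expReflect t := by
  have h := exp_neg_expReflect ht
  have h2 : Real.exp (-expReflect t) < 1 := by
    rw [h]
    linarith [Real.exp_pos (-t)]
  rw [Real.exp_lt_one_iff] at h2
  linarith

theorem expReflect_expReflect {t : ℝ} (ht : 0 < t) : expReflect (expReflect t) = t := by
  rw [expReflect, exp_neg_expReflect ht, sub_sub_cancel, Real.log_exp, neg_neg]

theorem injOn_expReflect : InjOn expReflect (Ioi 0) := fun a ha b hb h => by
  rw [← expReflect_expReflect ha, h, expReflect_expReflect hb]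

theorem image_expReflect : expReflect '' Ioi 0 = Ioi 0 := by
  ext v
  constructor
  · rintro ⟨t, ht, rfl⟩
    exact expReflect_pos ht
  · intro hv
    exact ⟨expReflect v, expReflect_pos hv, expReflect_expReflect hv⟩

theorem hasDerivAt_expReflect {t : ℝ} (ht : 0 < t) :
    HasDerivAt expReflect (-(Real.exp (-t) / (1 - Real.exp (-t)))) t := by
  have h := (((hasDerivAt_neg t).exp.const_sub 1).log (one_sub_exp_neg_pos ht).ne').neg
  convert! h using 1
  ring

theorem boseDenom_I (t : ℝ) : boseDenom I t = Real.exp t + Real.exp (-t) := by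
  simp [boseDenom]

theorem abs_deriv_expReflect_smul {t : ℝ} (ht : 0 < t) :
    |(-(Real.exp (-t) / (1 - Real.exp (-t))))| • (expReflect t ^ 2
      / skewCoshDenom (-1) (expReflect t)) = expReflect t ^ 2 / boseDenom I t := by
  have h1 := one_sub_exp_neg_pos ht
  have h2 : Real.exp (expReflect t) = (1 - Real.exp (-t))⁻¹ := by
    rw [← exp_neg_expReflect ht, Real.exp_neg, inv_inv]
  have h3 := skewCoshDenom_pos (κ := -1) (by norm_num) (expReflect t)
  have h4 : Real.exp t * Real.exp (-t) = 1 := by rw [← Real.exp_add]; simp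
  have h5 := boseDenom_pos (z := I) (by simp) t
  rw [abs_neg, abs_of_pos (by positivity), smul_eq_mul]
  rw [skewCoshDenom, exp_neg_expReflect ht, h2] at *
  rw [boseDenom_I] at *
  generalize Real.exp (-t) = x at *
  rw [mul_div_assoc', div_eq_div_iff h3.ne' h5.ne']
  field_simp
  linear_combination expReflect t ^ 2 * h4

theorem integrableOn_expReflect_sq_div :
    IntegrableOn (fun t => expReflect t ^ 2 / boseDenom I t) (Ioi 0) := by
  have h := integrableOn_Ioi_pow_div_skewCoshDenom 2 (κ := -1) (by norm_num)
  rw [← image_expReflect, integrableOn_image_iff_integrableOn_abs_deriv_smul measurableSet_Ioi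
    (fun t ht => (hasDerivAt_expReflect ht).hasDerivWithinAt) injOn_expReflect] at h
  exact h.congr_fun (fun t ht => abs_deriv_expReflect_smul ht) measurableSet_Ioi

theorem integral_expReflect_sq_div :
    ∫ t in Ioi (0 : ℝ), expReflect t ^ 2 / boseDenom I t
      = ∫ v in Ioi (0 : ℝ), v ^ 2 / skewCoshDenom (-1) v := by
  nth_rw 2 [← image_expReflect]
  rw [integral_image_eq_integral_abs_deriv_smul measurableSet_Ioi
    (fun t ht => (hasDerivAt_expReflect ht).hasDerivWithinAt) injOn_expReflect]
  exact (setIntegral_congr_fun measurableSet_Ioi fun t ht => abs_deriv_expReflect_smul ht).symm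

theorem exp_sub_one_pos {t : ℝ} (ht : 0 < t) : 0 < Real.exp t - 1 :=
  sub_pos.mpr (Real.one_lt_exp_iff.mpr ht)

/-- In the coordinate `x = e ^ (-t)` this is `log (x / (1 - x))`, a bijection of `(0, 1)` onto the
real line; hence the whole-line integral with `κ = 1`. -/
theorem expReflect_sub_self {t : ℝ} (ht : 0 < t) :
    expReflect t - t = -Real.log (Real.exp t - 1) := by
  have h : Real.exp t - 1 = Real.exp t * (1 - Real.exp (-t)) := by
    rw [mul_sub, ← Real.exp_add]
    simp
  rw [h, Real.log_mul (Real.exp_pos t).ne' (one_sub_exp_neg_pos ht).ne', Real.log_exp, expReflect]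
  ring

theorem injOn_neg_log_exp_sub_one : InjOn (fun t => -Real.log (Real.exp t - 1)) (Ioi 0) := by
  intro a ha b hb h
  have h1 := Real.log_injOn_pos (exp_sub_one_pos ha) (exp_sub_one_pos hb) (neg_injective h)
  exact Real.exp_injective (sub_left_injective h1)

theorem image_neg_log_exp_sub_one :
    (fun t => -Real.log (Real.exp t - 1)) '' Ioi 0 = univ := by
  refine eq_univ_of_forall fun v => ⟨Real.log (1 + Real.exp (-v)), ?_, ?_⟩
  · exact Real.log_pos (by linarith [Real.exp_pos (-v)])
  · simp only
    rw [Real.exp_log (by positivity), add_sub_cancel_left, Real.log_exp, neg_neg]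

theorem hasDerivAt_neg_log_exp_sub_one {t : ℝ} (ht : 0 < t) :
    HasDerivAt (fun t => -Real.log (Real.exp t - 1)) (-(Real.exp t / (Real.exp t - 1))) t :=
  (((Real.hasDerivAt_exp t).sub_const 1).log (exp_sub_one_pos ht).ne').neg

theorem abs_deriv_neg_log_exp_sub_one_smul {t : ℝ} (ht : 0 < t) :
    |(-(Real.exp t / (Real.exp t - 1)))| • ((-Real.log (Real.exp t - 1)) ^ 2
      / skewCoshDenom 1 (-Real.log (Real.exp t - 1)))
      = (expReflect t - t) ^ 2 / boseDenom I t := by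
  have h1 := exp_sub_one_pos ht
  have h3 := skewCoshDenom_pos (κ := 1) (by norm_num) (-Real.log (Real.exp t - 1))
  have h4 : Real.exp t * Real.exp (-t) = 1 := by rw [← Real.exp_add]; simp
  have h5 := boseDenom_pos (z := I) (by simp) t
  rw [abs_neg, abs_of_pos (by positivity), smul_eq_mul, expReflect_sub_self ht]
  rw [skewCoshDenom, neg_neg, Real.exp_neg, Real.exp_log h1] at h3 ⊢
  rw [boseDenom_I] at *
  generalize Real.exp (-t) = x at *
  rw [mul_div_assoc', div_eq_div_iff h3.ne' h5.ne']
  field_simp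
  linear_combination Real.log (Real.exp t - 1) ^ 2 * h4

theorem integral_expReflect_sub_sq_div :
    ∫ t in Ioi (0 : ℝ), (expReflect t - t) ^ 2 / boseDenom I t
      = ∫ v : ℝ, v ^ 2 / skewCoshDenom 1 v := by
  rw [← setIntegral_univ (f := fun v : ℝ => v ^ 2 / skewCoshDenom 1 v),
    ← image_neg_log_exp_sub_one, integral_image_eq_integral_abs_deriv_smul measurableSet_Ioi
      (fun t ht => (hasDerivAt_neg_log_exp_sub_one ht).hasDerivWithinAt)
      injOn_neg_log_exp_sub_one]
  exact (setIntegral_congr_fun measurableSet_Ioi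
    fun t ht => abs_deriv_neg_log_exp_sub_one_smul ht).symm

theorem integrableOn_expReflect_sub_sq_div :
    IntegrableOn (fun t => (expReflect t - t) ^ 2 / boseDenom I t) (Ioi 0) := by
  have h := (integrable_pow_div_skewCoshDenom 2 (κ := 1) (by norm_num)).integrableOn (s := univ)
  rw [← image_neg_log_exp_sub_one, integrableOn_image_iff_integrableOn_abs_deriv_smul
    measurableSet_Ioi (fun t ht => (hasDerivAt_neg_log_exp_sub_one ht).hasDerivWithinAt)
    injOn_neg_log_exp_sub_one] at h
  exact h.congr_fun (fun t ht => abs_deriv_neg_log_exp_sub_one_smul ht) measurableSet_Ioi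

/-! ### Logarithmic integrals against `dx / (1 + x ^ 2)`. -/

theorem exp_two_pi_mul_one_quarter_mul_I :
    Complex.exp ((2 * Real.pi * (1 / 4) : ℝ) * I) = I := by
  rw [show 2 * Real.pi * (1 / 4) = Real.pi / 2 by ring]
  push_cast
  exact Complex.exp_pi_div_two_mul_I

theorem integral_sq_div_boseDenom_I :
    ∫ t in Ioi (0 : ℝ), t ^ 2 / boseDenom I t = Real.pi ^ 3 / 16 := by
  have h1 := im_polylog_three_exp (x := 1 / 4) (by norm_num)
  have h2 := im_polylog_eq_integral 2 (z := I) (by simp)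
  rw [show (((2 : ℕ) : ℂ) + 1) = 3 by norm_num] at h2
  rw [exp_two_pi_mul_one_quarter_mul_I, h2] at h1
  norm_num [Nat.factorial] at h1
  linarith

theorem integral_div_boseDenom_I :
    ∫ t in Ioi (0 : ℝ), t / boseDenom I t = catalanConst := by
  have h := im_polylog_eq_integral 1 (z := I) (by simp)
  rw [show (((1 : ℕ) : ℂ) + 1) = 2 by norm_num, im_polylog_two_I] at h
  simpa using h.symm

theorem integral_mul_exp_neg_div_boseDenom_I :
    ∫ t in Ioi (0 : ℝ), t * Real.exp (-t) / boseDenom I t = Real.pi ^ 2 / 48 := by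
  have h1 := re_polylog_two_exp (x := 1 / 4) (by norm_num)
  have h2 := re_polylog_eq_integral 1 (z := I) (by simp)
  rw [show (((1 : ℕ) : ℂ) + 1) = 2 by norm_num] at h2
  rw [exp_two_pi_mul_one_quarter_mul_I, h2] at h1
  simp only [pow_one, I_re, normSq_I, one_mul, zero_sub, Nat.factorial_one, Nat.cast_one,
    div_one, neg_div, mul_neg, integral_neg, ← mul_div_assoc] at h1
  linarith

theorem integrableOn_mul_expReflect_div :
    IntegrableOn (fun t => t * expReflect t / boseDenom I t) (Ioi 0) := by
  have h := (((integrableOn_pow_div_boseDenom 2 (z := I) (by simp)).add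
    integrableOn_expReflect_sq_div).sub integrableOn_expReflect_sub_sq_div).const_mul (1 / 2)
  refine h.congr (Filter.Eventually.of_forall fun t => ?_)
  simp only [Pi.add_apply, Pi.sub_apply]
  ring

/-- Polarization of the product `log x * log (1 - x)` into three squares, each already evaluated. -/
theorem integral_mul_expReflect_div :
    ∫ t in Ioi (0 : ℝ), t * expReflect t / boseDenom I t
      = 3 * Real.pi ^ 3 / 64 + Real.pi * Real.log 2 ^ 2 / 16 - (polylog 3 (1 + I)).im := by
  have i1 := integrableOn_pow_div_boseDenom 2 (z := I) (by simp)
  have h : ∫ t in Ioi (0 : ℝ), t * expReflect t / boseDenom I t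
      = 1 / 2 * ((∫ t in Ioi (0 : ℝ), t ^ 2 / boseDenom I t)
        + (∫ t in Ioi (0 : ℝ), expReflect t ^ 2 / boseDenom I t)
        - ∫ t in Ioi (0 : ℝ), (expReflect t - t) ^ 2 / boseDenom I t) := by
    rw [← integral_add i1 integrableOn_expReflect_sq_div]
    refine Eq.trans ?_ (congrArg (1 / 2 * ·) (integral_sub
      (i1.add integrableOn_expReflect_sq_div) integrableOn_expReflect_sub_sq_div))
    rw [← integral_const_mul]
    refine integral_congr_ae (Filter.Eventually.of_forall fun t => ?_)
    simp only
    ring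
  rw [h, integral_sq_div_boseDenom_I, integral_expReflect_sq_div,
    integral_Ioi_sq_div_skewCoshDenom_neg_one, integral_expReflect_sub_sq_div,
    integral_sq_div_skewCoshDenom_one]
  ring

/-! ### Generating function of the moments and the base sum. -/

theorem summable_arctanMoment_mul_pow {y : ℝ} (hy0 : 0 ≤ y) (hy1 : y < 1) :
    Summable fun k : ℕ => arctanMoment k * y ^ k := by
  obtain ⟨B, hB⟩ := exists_abs_arctanMoment_le
  refine Summable.of_norm_bounded ((summable_geometric_of_lt_one hy0 hy1).mul_left B) fun k => ?_
  rw [norm_mul, Real.norm_eq_abs, norm_pow, Real.norm_of_nonneg hy0]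
  gcongr
  exact hB k

/-- Multiplying the recursion by `y ^ (k + 2)` and summing gives a linear equation for the
generating function; the inhomogeneous term is the logarithm series. -/
theorem tsum_arctanMoment_mul_pow {y : ℝ} (hy0 : 0 ≤ y) (hy1 : y < 1) :
    (1 + y ^ 2) * ∑' k : ℕ, arctanMoment (k + 1) * y ^ (k + 1)
      = y * (-Real.log (1 - y) + Real.log 2 / 2 - Real.pi / 4 * y) := by
  have hs := summable_arctanMoment_mul_pow hy0 hy1
  have hlog := (Real.hasSum_pow_div_log_of_abs_lt_one (x := y) (by rwa [abs_of_nonneg hy0]))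
  have e0 := hs.tsum_eq_zero_add
  have e1 := ((summable_nat_add_iff 1).mpr hs).tsum_eq_zero_add
  have e2 : ∑' k : ℕ, arctanMoment (k + 2) * y ^ (k + 2)
      = y * -Real.log (1 - y) - y ^ 2 * ∑' k : ℕ, arctanMoment k * y ^ k := by
    rw [← ((hlog.mul_left y).sub (hs.hasSum.mul_left (y ^ 2))).tsum_eq]
    congr 1
    funext k
    rw [arctanMoment_add_two]
    have : (k : ℝ) + 1 ≠ 0 := by positivity
    field_simp
    ring
  simp only [zero_add, add_assoc, Nat.reduceAdd, pow_zero, mul_one, pow_one] at e0 e1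
  rw [e0] at e2
  have v0 : arctanMoment 0 = Real.pi / 4 := rfl
  have v1 : arctanMoment 1 = Real.log 2 / 2 := rfl
  rw [v0] at e2
  rw [v1] at e1
  linear_combination e1 + e2

theorem integral_mul_exp_neg_mul {r : ℝ} (hr : 0 < r) :
    ∫ t in Ioi (0 : ℝ), t * Real.exp (-(r * t)) = 1 / r ^ 2 := by
  have h := Real.integral_rpow_mul_exp_neg_mul_Ioi (a := 2) two_pos hr
  norm_num at h
  rw [one_div, h]

theorem hasSum_arctanMoment_div_sq :
    HasSum (fun k : ℕ => arctanMoment (k + 1) / ((k : ℝ) + 1) ^ 2)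
      (Real.pi ^ 3 / 24 + catalanConst * Real.log 2 / 2 + Real.pi * Real.log 2 ^ 2 / 16
        - (polylog 3 (1 + I)).im) := by
  obtain ⟨B, hB⟩ := exists_abs_arctanMoment_le
  have hval : ∀ k : ℕ, ∫ t in Ioi (0 : ℝ), t * Real.exp (-(((k : ℝ) + 1) * t))
      = 1 / ((k : ℝ) + 1) ^ 2 := fun k => integral_mul_exp_neg_mul (by positivity)
  -- The integral of a non-integrable function is `0` by convention, so a nonzero value certifies
  -- integrability; the same device gives `i3`.
  have hint : ∀ k : ℕ, IntegrableOn (fun t : ℝ => t * Real.exp (-(((k : ℝ) + 1) * t)))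
      (Ioi 0) := fun k => Integrable.of_integral_ne_zero (by rw [hval]; positivity)
  have hnorm : ∀ k : ℕ, ∫ t in Ioi (0 : ℝ),
      ‖arctanMoment (k + 1) * (t * Real.exp (-(((k : ℝ) + 1) * t)))‖
        = |arctanMoment (k + 1)| * (1 / ((k : ℝ) + 1) ^ 2) := by
    intro k
    rw [← hval, ← integral_const_mul]
    refine setIntegral_congr_fun measurableSet_Ioi fun t ht => ?_
    have ht0 : (0 : ℝ) < t := ht
    rw [norm_mul, Real.norm_eq_abs, Real.norm_of_nonneg (by positivity)]
  have hsum : Summable fun k : ℕ => ∫ t in Ioi (0 : ℝ),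
      ‖arctanMoment (k + 1) * (t * Real.exp (-(((k : ℝ) + 1) * t)))‖ := by
    have h2 : Summable fun k : ℕ => 1 / ((k : ℝ) + 1) ^ 2 := by
      have := (summable_nat_add_iff 1).mpr hasSum_zeta_two.summable
      simpa using this
    refine Summable.of_nonneg_of_le (fun k => integral_nonneg fun t => norm_nonneg _)
      (fun k => ?_) (h2.mul_left B)
    rw [hnorm]
    gcongr
    exact hB _
  have key := hasSum_integral_of_summable_integral_norm
    (fun k => (hint k).const_mul (arctanMoment (k + 1))) hsum
  have i1 := integrableOn_mul_expReflect_div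
  have i2 : IntegrableOn (fun t => t / boseDenom I t) (Ioi 0) := by
    simpa using integrableOn_pow_div_boseDenom 1 (z := I) (by simp)
  have i3 : IntegrableOn (fun t => t * Real.exp (-t) / boseDenom I t) (Ioi 0) := by
    refine Integrable.of_integral_ne_zero ?_
    rw [integral_mul_exp_neg_div_boseDenom_I]
    positivity
  convert! key using 1
  · funext k
    rw [integral_const_mul, hval, mul_one_div]
  -- With `y = e ^ (-t)`, the factor `y / (1 + y ^ 2)` from the generating function is `1 /
  -- boseDenom I t`.
  · have hfun : ∀ t ∈ Ioi (0 : ℝ),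
        ∑' k : ℕ, arctanMoment (k + 1) * (t * Real.exp (-(((k : ℝ) + 1) * t)))
          = t * expReflect t / boseDenom I t + Real.log 2 / 2 * (t / boseDenom I t)
            - Real.pi / 4 * (t * Real.exp (-t) / boseDenom I t) := by
      intro t ht
      have ht0 : (0 : ℝ) < t := ht
      have hy := tsum_arctanMoment_mul_pow (Real.exp_pos (-t)).le
        (Real.exp_lt_one_iff.mpr (by linarith))
      have hexp : ∀ k : ℕ, Real.exp (-(((k : ℝ) + 1) * t)) = Real.exp (-t) ^ (k + 1) := by
        intro k
        rw [← Real.exp_nat_mul]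
        congr 1
        push_cast
        ring
      have hpull : ∑' k : ℕ, arctanMoment (k + 1) * (t * Real.exp (-(((k : ℝ) + 1) * t)))
          = t * ∑' k : ℕ, arctanMoment (k + 1) * Real.exp (-t) ^ (k + 1) := by
        rw [← tsum_mul_left]
        congr 1
        funext k
        rw [hexp]
        ring
      have h4 : Real.exp t * Real.exp (-t) = 1 := by rw [← Real.exp_add]; simp
      have h5 := boseDenom_pos (z := I) (by simp) t
      rw [hpull, expReflect]
      generalize ∑' k : ℕ, arctanMoment (k + 1) * Real.exp (-t) ^ (k + 1) = T at hy ⊢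
      field_simp
      rw [boseDenom_I]
      linear_combination (8 * Real.exp t) * hy + 8 * (-Real.log (1 - Real.exp (-t))
        + Real.log 2 / 2 - Real.pi / 4 * Real.exp (-t) - T * Real.exp (-t)) * h4
    rw [setIntegral_congr_fun measurableSet_Ioi hfun]
    refine Eq.trans ?_ (integral_sub (i1.add (i2.const_mul (Real.log 2 / 2)))
      (i3.const_mul (Real.pi / 4))).symm
    rw [show (∫ t in Ioi (0 : ℝ), ((fun t => t * expReflect t / boseDenom I t)
        + fun t => Real.log 2 / 2 * (t / boseDenom I t)) t) = _ from
        integral_add i1 (i2.const_mul (Real.log 2 / 2)),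
      integral_const_mul, integral_const_mul, integral_mul_expReflect_div,
      integral_div_boseDenom_I, integral_mul_exp_neg_div_boseDenom_I]
    ring

/-! ### Starting values of the two parity classes and the final assembly. -/

theorem hasSum_arctanMoment_add_three :
    HasSum (fun k : ℕ => 4 * arctanMoment (k + 3) / ((k : ℝ) + 1) ^ 2)
      (-4 + 2 / 3 * Real.pi ^ 2 - (Real.pi ^ 3 / 6 + 2 * catalanConst * Real.log 2
        + Real.pi / 4 * Real.log 2 ^ 2 - 4 * (polylog 3 (1 + I)).im)) := by
  have h := hasSum_arctanMoment_div_sq.mul_left 4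
  simp only [← mul_div_assoc] at h
  convert! h.arctanMoment_shift one_ne_zero using 1
  rw [show harmonic 1 = 1 by simp [harmonic]]
  push_cast
  ring

theorem hasSum_arctanMoment_add_five :
    HasSum (fun k : ℕ => 4 * arctanMoment (k + 5) / ((k : ℝ) + 1) ^ 2)
      (86 / 27 - 4 / 9 * Real.pi ^ 2 + (Real.pi ^ 3 / 6 + 2 * catalanConst * Real.log 2
        + Real.pi / 4 * Real.log 2 ^ 2 - 4 * (polylog 3 (1 + I)).im)) := by
  convert! hasSum_arctanMoment_add_three.arctanMoment_shift three_ne_zero using 1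
  rw [show harmonic 3 = 11 / 6 by norm_num [harmonic, Finset.sum_range_succ]]
  push_cast
  ring

theorem hasSum_digamma_sub_digamma {n : ℕ} {v : ℝ}
    (h : HasSum (fun k : ℕ => 4 * arctanMoment (k + (2 * n + 3)) / ((k : ℝ) + 1) ^ 2) v) :
    HasSum (fun k : ℕ => (Complex.digamma ((((k : ℂ) + 1) + 2 * (n : ℂ) + 5) / 4)
      - Complex.digamma ((((k : ℂ) + 1) + 2 * (n : ℂ) + 3) / 4)) / ((k : ℂ) + 1) ^ 2)
      (v : ℂ) := by
  convert! Complex.hasSum_ofReal.mpr h using 1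
  funext k
  have hk := digamma_sub_digamma_eq_arctanMoment (k + (2 * n + 3))
  rw [Complex.ofReal_div, ← hk]
  push_cast
  congr 4 <;> ring

theorem theorem5 (n : ℕ) :
    (n = 0 →
      HasSum
        (fun k : ℕ =>
          (Complex.digamma ((((k : ℂ) + 1) + 2 * (n : ℂ) + 5) / 4)
            - Complex.digamma ((((k : ℂ) + 1) + 2 * (n : ℂ) + 3) / 4)) / ((k : ℂ) + 1) ^ 2)
        ((-4 + 2 * Real.pi ^ 2 / 3 - Real.pi ^ 3 / 6
            - 2 * catalanConst * Real.log 2 - Real.pi / 4 * Real.log 2 ^ 2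
            + 4 * (polylog 3 (1 + Complex.I)).im : ℝ) : ℂ)) ∧
    (n = 1 →
      HasSum
        (fun k : ℕ =>
          (Complex.digamma ((((k : ℂ) + 1) + 2 * (n : ℂ) + 5) / 4)
            - Complex.digamma ((((k : ℂ) + 1) + 2 * (n : ℂ) + 3) / 4)) / ((k : ℂ) + 1) ^ 2)
        ((86 / 27 - 4 * Real.pi ^ 2 / 9 + Real.pi ^ 3 / 6
            + 2 * catalanConst * Real.log 2 + Real.pi / 4 * Real.log 2 ^ 2
            - 4 * (polylog 3 (1 + Complex.I)).im : ℝ) : ℂ)) ∧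
    (Odd n → n ≠ 1 →
      HasSum
        (fun k : ℕ =>
          (Complex.digamma ((((k : ℂ) + 1) + 2 * (n : ℂ) + 5) / 4)
            - Complex.digamma ((((k : ℂ) + 1) + 2 * (n : ℂ) + 3) / 4)) / ((k : ℂ) + 1) ^ 2)
        ((86 / 27
            - 2 * ∑ j ∈ Finset.Icc 1 ((n - 1) / 2),
                (8 * (j : ℝ) + 5) / ((2 * (j : ℝ) + 1) * (4 * (j : ℝ) + 3) ^ 3)
            + 32 * ∑ j ∈ Finset.Icc 1 ((n - 1) / 2),
                (2 * (j : ℝ) + 1) * ((harmonic (4 * j + 1) : ℚ) : ℝ)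
                  / ((4 * (j : ℝ) + 3) ^ 2 * (4 * (j : ℝ) + 1) ^ 2)
            - (4 / 9 + 4 / 3 * ∑ j ∈ Finset.Icc 1 ((n - 1) / 2),
                1 / ((4 * (j : ℝ) + 3) * (4 * (j : ℝ) + 1))) * Real.pi ^ 2
            + Real.pi ^ 3 / 6
            + 2 * catalanConst * Real.log 2 + Real.pi / 4 * Real.log 2 ^ 2
            - 4 * (polylog 3 (1 + Complex.I)).im : ℝ) : ℂ)) ∧
    (Even n →
      HasSum
        (fun k : ℕ =>
          (Complex.digamma ((((k : ℂ) + 1) + 2 * (n : ℂ) + 5) / 4)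
            - Complex.digamma ((((k : ℂ) + 1) + 2 * (n : ℂ) + 3) / 4)) / ((k : ℂ) + 1) ^ 2)
        -- `Finset.range (n / 2)` is `0 ≤ j ≤ (n - 2) / 2` (empty for `n = 0`).
        ((-4
            - ∑ j ∈ Finset.range (n / 2),
                (8 * (j : ℝ) + 9) / (((j : ℝ) + 1) * (4 * (j : ℝ) + 5) ^ 3)
            + 64 * ∑ j ∈ Finset.range (n / 2),
                ((j : ℝ) + 1) * ((harmonic (4 * j + 3) : ℚ) : ℝ)
                  / ((4 * (j : ℝ) + 5) ^ 2 * (4 * (j : ℝ) + 3) ^ 2)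
            + (2 / 3 - 4 / 3 * ∑ j ∈ Finset.range (n / 2),
                1 / ((4 * (j : ℝ) + 5) * (4 * (j : ℝ) + 3))) * Real.pi ^ 2
            - Real.pi ^ 3 / 6
            - 2 * catalanConst * Real.log 2 - Real.pi / 4 * Real.log 2 ^ 2
            + 4 * (polylog 3 (1 + Complex.I)).im : ℝ) : ℂ)) := by
  refine ⟨?_, ?_, ?_, ?_⟩
  · rintro rfl
    refine hasSum_digamma_sub_digamma ?_
    convert! hasSum_arctanMoment_add_three using 1
    ring
  · rintro rfl
    refine hasSum_digamma_sub_digamma ?_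
    convert! hasSum_arctanMoment_add_five using 1
    ring
  · rintro ⟨m, rfl⟩ -
    refine hasSum_digamma_sub_digamma ?_
    rw [show 2 * (2 * m + 1) + 3 = 4 * m + 5 by ring,
      show (2 * m + 1 - 1) / 2 = m by omega]
    convert! hasSum_arctanMoment_odd hasSum_arctanMoment_add_five m using 1
    ring
  · rintro ⟨m, rfl⟩
    refine hasSum_digamma_sub_digamma ?_
    rw [show 2 * (m + m) + 3 = 4 * m + 3 by ring, show (m + m) / 2 = m by omega]
    convert! hasSum_arctanMoment_even hasSum_arctanMoment_add_three m using 1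
    ring
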